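/- Let $\mathsf{PreOrd}(\mathsf{Set})$ be the category of preordered sets and monotone maps, let $\mathsf{ParOrd}(\mathsf{Set})$ be its full subcategory of partially ordered sets, with inclusion $U$, reflector $F \dashv U$ sending $(A,\rho)$ to the quotient of $A$ by $\rho\wedge\rho^{o}$ with the induced order, and unit $\eta$. A morphism $g\colon X\to Y$ of $\mathsf{PreOrd}(\mathsf{Set})$ is a *trivial covering* if the naturality square $\eta_Y\, g = UF(g)\,\eta_X$ is a pullback; a morphism $p\colon E\to B$ is an *effective descent morphism* if the pullback functor $p^*\colon \mathsf{PreOrd}(\mathsf{Set})/B\to\mathsf{PreOrd}(\mathsf{Set})/E$ is monadic; and $f\colon A\to B$ is a *covering* if there is an effective descent morphism $p\colon E\to B$ such that the projection $E\times_B A\to E$ is a trivial covering. Let $\mathcal N$ be the ideal of morphisms that factor through a discrete preordered set, i.e. one that is both an equivalence relation and a partial order; an *$\mathcal N$-kernel* of $f\colon A\to B$ is a morphism $\kappa\colon K\to A$ with $f\kappa\in\mathcal N$ such that every $\lambda\colon X\to A$ with $f\lambda\in\mathcal N$ factors as $\lambda=\kappa\lambda'$ for a unique $\lambda'\colon X\to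 K$. Let $f\colon(A,\rho)\to(B,\sigma)$ be a morphism in $\mathsf{PreOrd}(\mathsf{Set})$, and let $\mathrm{Eq}(f)=\{(a,a')\in A\times A : f(a)=f(a')\}$. Then the morphism $(A,\rho\wedge \mathrm{Eq}(f))\to(A,\rho)$ given by the identity map of $A$ is an $\mathcal N$-kernel of $f$, and $f$ is a covering if and only if its $\mathcal N$-kernel $(A,\rho\wedge \mathrm{Eq}(f))$ (equivalently, the domain of any other $\mathcal N$-kernel of $f$) is a partial order. -/

import Mathlib

open CategoryTheory CategoryTheory.Limits

universe u v₁ v₂ u₁ u₂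

namespace PreOrdGalois

/-! ### Ideals of morphisms and kernels relative to a class of trivial objects -/

section Kernels

variable {C : Type u₁} [Category.{v₁} C]

/-- The ideal of morphisms that factor through an object of the class `Z` of trivial objects. -/
def FactorsThrough (Z : ObjectProperty C) : MorphismProperty C := fun X Y f =>
  ∃ (T : C) (_ : Z T) (g : X ⟶ T) (h : T ⟶ Y), g ≫ h = f

/-- `κ : K ⟶ X` is an `N`-kernel of `f : X ⟶ Y`: the composite of `κ` with `f` lies in `N`, and
`κ` is universal with this property. -/
def IsNKernel (N : MorphismProperty C) {K X Y : C} (κ : K ⟶ X) (f : X ⟶ Y) : Prop :=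
  N (κ ≫ f) ∧ ∀ ⦃W : C⦄ (l : W ⟶ X), N (l ≫ f) → ∃! l' : W ⟶ K, l' ≫ κ = l

end Kernels

/-! ### Coverings for the Galois structure of an adjunction -/

section Coverings

variable {𝓑 : Type u₁} [Category.{v₁} 𝓑]

/-- `p : E ⟶ B` is an effective descent morphism: the change-of-base functor
`p* : 𝓑 / B ⥤ 𝓑 / E` is monadic. -/
def IsEffectiveDescent [HasPullbacks 𝓑] {E B : 𝓑} (p : E ⟶ B) : Prop :=
  Nonempty (MonadicRightAdjoint (Over.pullback p))

variable {𝓐 : Type u₂} [Category.{v₂} 𝓐] {G : 𝓑 ⥤ 𝓐} {V : 𝓐 ⥤ 𝓑}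

/-- `f` is a trivial covering for the Galois structure of the adjunction `G ⊣ V` (with respect to
all morphisms): the naturality square of the unit at `f` is a pullback. -/
def IsTrivialCovering (adj : G ⊣ V) {X Y : 𝓑} (f : X ⟶ Y) : Prop :=
  IsPullback (adj.unit.app X) f (V.map (G.map f)) (adj.unit.app Y)

/-- `f : A ⟶ B` is a covering for the Galois structure of the adjunction `G ⊣ V`: its pullback
`E ×_B A ⟶ E` along some effective descent morphism `p : E ⟶ B` is a trivial covering. -/
def IsCovering [HasPullbacks 𝓑] (adj : G ⊣ V) {A B : 𝓑} (f : A ⟶ B) : Prop :=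
  ∃ (E : 𝓑) (p : E ⟶ B), IsEffectiveDescent p ∧ IsTrivialCovering adj (pullback.fst p f)

end Coverings

/-! ### Preordered sets -/

/-- The preordered sets that are equivalence relations. -/
def eqRel : ObjectProperty Preord.{u} := fun X => ∀ x y : X, x ≤ y → y ≤ x

/-- The preordered sets that are partial orders. -/
def parOrd : ObjectProperty Preord.{u} := fun X => ∀ x y : X, x ≤ y → y ≤ x → x = y

/-- The trivial objects: preordered sets that are both equivalence relations and partial orders,
that is, the discrete ones. -/
def dis : ObjectProperty Preord.{u} := eqRel ⊓ parOrd

/-- The preordered set `(A, ρ ∧ Eq(f))`, for a morphism `f : (A, ρ) ⟶ (B, σ)`. -/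
def nKer {A B : Preord.{u}} (f : A ⟶ B) : Preord.{u} where
  carrier := A
  str :=
    { le := fun a a' => a ≤ a' ∧ f a = f a'
      lt := fun a a' => (a ≤ a' ∧ f a = f a') ∧ ¬ (a' ≤ a ∧ f a' = f a)
      lt_iff_le_not_ge := fun _ _ => Iff.rfl
      le_refl := fun a => ⟨le_refl a, rfl⟩
      le_trans := fun _ _ _ h h' => ⟨h.1.trans h'.1, h.2.trans h'.2⟩ }

/-- The morphism `(A, ρ ∧ Eq(f)) ⟶ (A, ρ)` carried by the identity map of `A`. -/
def nKerι {A B : Preord.{u}} (f : A ⟶ B) : nKer f ⟶ A :=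
  Preord.ofHom (X := nKer f) (Y := A) ⟨fun a => a, fun _ _ h => h.1⟩

/-- Two morphisms of preordered sets with the same codomain have a pullback, the set of compatible
pairs with the componentwise preorder. -/
theorem preord_isPullback {X Y Z : Preord.{u}} (f : X ⟶ Z) (g : Y ⟶ Z) :
    IsPullback
      (Preord.ofHom (X := {q : X × Y // f q.1 = g q.2}) (Y := X)
        ⟨fun q => q.1.1, fun _ _ h => h.1⟩)
      (Preord.ofHom (X := {q : X × Y // f q.1 = g q.2}) (Y := Y)
        ⟨fun q => q.1.2, fun _ _ h => h.2⟩) f g := by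
  refine ⟨⟨Preord.ext fun q => q.2⟩, ⟨PullbackCone.IsLimit.mk _
    (fun s => Preord.ofHom (X := s.pt) (Y := {q : X × Y // f q.1 = g q.2})
      ⟨fun w => ⟨(s.fst w, s.snd w), ConcreteCategory.congr_hom s.condition w⟩,
        fun _ _ h => ⟨s.fst.hom.monotone h, s.snd.hom.monotone h⟩⟩)
    (fun s => rfl) (fun s => rfl) (fun s m h₁ h₂ => Preord.ext fun w => Subtype.ext
      (Prod.ext (ConcreteCategory.congr_hom h₁ w) (ConcreteCategory.congr_hom h₂ w)))⟩⟩

instance preord_hasPullbacks : HasPullbacks Preord.{u} :=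
  have : ∀ {X Y Z : Preord.{u}} {f : X ⟶ Z} {g : Y ⟶ Z}, HasLimit (cospan f g) :=
    fun {_ _ _ f g} => (preord_isPullback f g).hasPullback
  hasPullbacks_of_hasLimit_cospan _

end PreOrdGalois

namespace PreOrdGalois

/-! ### Elements of pullbacks and isomorphisms of preordered sets -/

section Elements

variable {P X Y Z : Preord.{u}} {fst : P ⟶ X} {snd : P ⟶ Y} {f : X ⟶ Z} {g : Y ⟶ Z}

/-! If `f` becomes a trivial covering after pullback along an effective descent morphism `p`, then,
`p` being surjective, two equivalent points of one fibre of `f` lift to the pullback with the same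
coordinate in `E`. The lifts are equivalent and lie in one fibre of a trivial covering, so they
coincide: `nKer f` is a partial order.

Conversely, every `B` is covered by the partial order `levels B`. If `nKer f` is a partial order, so
is the pullback of `A` to `levels B`, and a morphism between partial orders is a trivial covering
because both units are isomorphisms.

The weight lies in `LiftsChains.isEffectiveDescent`, applied to `levelsπ B`. It rests on Beck's
monadicity theorem: the relevant coequalizers are set-theoretical quotients with the image order,
and that order is transitive because the pair splits after pulling back. -/

theorem exists_of_isPullback (h : IsPullback fst snd f g) (x : X) (y : Y) (hxy : f x = g y) :
    ∃ z : P, fst z = x ∧ snd z = y := by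
  let i := (preord_isPullback f g).isoIsPullback X Y h
  refine ⟨i.hom ⟨(x, y), hxy⟩, ?_, ?_⟩
  · rw [← Preord.comp_apply, IsPullback.isoIsPullback_hom_fst]; rfl
  · rw [← Preord.comp_apply, IsPullback.isoIsPullback_hom_snd]; rfl

theorem le_of_isPullback (h : IsPullback fst snd f g) {z z' : P} (h₁ : fst z ≤ fst z')
    (h₂ : snd z ≤ snd z') : z ≤ z' := by
  let i := h.isoIsPullback X Y (preord_isPullback f g)
  have hi : ∀ w : P, (i.hom w).1 = (fst w, snd w) := fun w => Prod.ext
    (ConcreteCategory.congr_hom (h.isoIsPullback_hom_fst X Y (preord_isPullback f g)) w)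
    (ConcreteCategory.congr_hom (h.isoIsPullback_hom_snd X Y (preord_isPullback f g)) w)
  have key : i.hom z ≤ i.hom z' := by
    change (i.hom z).1 ≤ (i.hom z').1
    rw [hi, hi]
    exact ⟨h₁, h₂⟩
  simpa using i.inv.hom.monotone key

theorem ext_of_isPullback (h : IsPullback fst snd f g) {z z' : P} (h₁ : fst z = fst z')
    (h₂ : snd z = snd z') : z = z' := by
  let i := h.isoIsPullback X Y (preord_isPullback f g)
  have hi : ∀ w : P, (i.hom w).1 = (fst w, snd w) := fun w => Prod.ext
    (ConcreteCategory.congr_hom (h.isoIsPullback_hom_fst X Y (preord_isPullback f g)) w)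
    (ConcreteCategory.congr_hom (h.isoIsPullback_hom_snd X Y (preord_isPullback f g)) w)
  have key : i.hom z = i.hom z' := Subtype.ext (by rw [hi, hi, h₁, h₂])
  simpa using congrArg i.inv key

theorem isIso_of_bijective (f : X ⟶ Y) (hf : Function.Bijective f)
    (hle : ∀ x x', f x ≤ f x' → x ≤ x') : IsIso f :=
  (Preord.Iso.mk (α := X) (β := Y)
    { toEquiv := Equiv.ofBijective f hf
      map_rel_iff' := fun {x x'} => ⟨hle x x', fun h => f.hom.monotone h⟩ }).isIso_hom

end Elements

/-! ### Kernels -/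

theorem dis_iff {T : Preord.{u}} : dis T ↔ ∀ x y : T, x ≤ y → x = y :=
  ⟨fun h x y hxy => h.2 x y hxy (h.1 x y hxy),
    fun h => ⟨fun x y hxy => (h x y hxy).ge, fun x y hxy _ => h x y hxy⟩⟩

/-- A morphism factors through a discrete preordered set if and only if it identifies comparable
elements. -/
theorem factorsThrough_dis_iff {X Y : Preord.{u}} (f : X ⟶ Y) :
    FactorsThrough dis f ↔ ∀ x x' : X, x ≤ x' → f x = f x' := by
  constructor
  · rintro ⟨T, hT, g, h, rfl⟩ x x' hx
    simp only [Preord.comp_apply]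
    rw [dis_iff.1 hT _ _ (g.hom.monotone hx)]
  · intro hf
    let T : Preord.{u} :=
      { carrier := Y
        str :=
          { le := fun y y' => y = y'
            lt := fun y y' => y = y' ∧ ¬ y' = y
            lt_iff_le_not_ge := fun _ _ => Iff.rfl
            le_refl := fun _ => rfl
            le_trans := fun _ _ _ => Eq.trans } }
    exact ⟨T, dis_iff.2 fun _ _ h => h,
      Preord.ofHom (X := X) (Y := T) ⟨fun x => f x, fun x x' hx => hf x x' hx⟩,
      Preord.ofHom (X := T) (Y := Y) ⟨fun y => y, fun _ _ h => le_of_eq h⟩, rfl⟩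

theorem isNKernel_nKerι {A B : Preord.{u}} (f : A ⟶ B) :
    IsNKernel (FactorsThrough dis) (nKerι f) f := by
  refine ⟨(factorsThrough_dis_iff _).2 fun x x' hx => hx.2, fun W l hl => ?_⟩
  rw [factorsThrough_dis_iff] at hl
  exact ⟨Preord.ofHom (X := W) (Y := nKer f)
      ⟨fun w => l w, fun w w' h => ⟨l.hom.monotone h, hl w w' h⟩⟩, rfl,
    fun l' hl' => Preord.ext fun w => ConcreteCategory.congr_hom hl' w⟩

theorem parOrd_of_iso {X Y : Preord.{u}} (i : X ≅ Y) (hX : parOrd X) : parOrd Y := fun y y' h h' => by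
  simpa using congrArg i.hom (hX _ _ (i.inv.hom.monotone h) (i.inv.hom.monotone h'))

/-- Two kernels of the same morphism have isomorphic domains. -/
theorem IsNKernel.nonempty_iso {C : Type u₁} [Category.{v₁} C] {N : MorphismProperty C}
    {K L X Y : C} {κ : K ⟶ X} {l : L ⟶ X} {f : X ⟶ Y} (hκ : IsNKernel N κ f)
    (hl : IsNKernel N l f) : Nonempty (K ≅ L) := by
  obtain ⟨s, hs, -⟩ := hl.2 κ hκ.1
  obtain ⟨t, ht, -⟩ := hκ.2 l hl.1
  exact ⟨s, t, (hκ.2 κ hκ.1).unique (by rw [Category.assoc, ht, hs]) (Category.id_comp _),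
    (hl.2 l hl.1).unique (by rw [Category.assoc, hs, ht]) (Category.id_comp _)⟩

/-! ### Trivial coverings -/

theorem unit_apply_eq_iff {X : Preord.{u}} (x x' : X) :
    preordToPartOrdForgetAdjunction.unit.app X x = preordToPartOrdForgetAdjunction.unit.app X x' ↔
      x ≤ x' ∧ x' ≤ x :=
  Quotient.eq''

theorem isIso_unit_app {X : Preord.{u}} (hX : parOrd X) :
    IsIso (preordToPartOrdForgetAdjunction.unit.app X) :=
  isIso_of_bijective _
    ⟨fun x x' h => hX x x' ((unit_apply_eq_iff x x').1 h).1 ((unit_apply_eq_iff x x').1 h).2,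
      fun y => Quotient.inductionOn' y fun x => ⟨x, rfl⟩⟩ fun _ _ h => h

theorem isTrivialCovering_of_parOrd {X Y : Preord.{u}} (f : X ⟶ Y) (hX : parOrd X)
    (hY : parOrd Y) : IsTrivialCovering preordToPartOrdForgetAdjunction f :=
  have := isIso_unit_app hX
  have := isIso_unit_app hY
  IsPullback.of_horiz_isIso ⟨(preordToPartOrdForgetAdjunction.unit.naturality f).symm⟩

/-- A trivial covering is injective on equivalence classes. -/
theorem IsTrivialCovering.eq_of_le_of_ge {X Y : Preord.{u}} {f : X ⟶ Y}
    (hf : IsTrivialCovering preordToPartOrdForgetAdjunction f) {x x' : X} (h : x ≤ x')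
    (h' : x' ≤ x) (hxx' : f x = f x') : x = x' :=
  ext_of_isPullback hf ((unit_apply_eq_iff x x').2 ⟨h, h'⟩) hxx'

/-! ### Effective descent morphisms -/

/-- An effective descent morphism of preordered sets is surjective. -/
theorem IsEffectiveDescent.surjective {E B : Preord.{u}} {p : E ⟶ B}
    (hp : IsEffectiveDescent p) : Function.Surjective p := by
  obtain ⟨hp⟩ := hp
  intro b
  by_contra hb
  -- A monadic functor is an equivalence followed by the forgetful functor of a category of
  -- algebras, hence reflects isomorphisms.
  have hR : (Over.pullback p).ReflectsIsomorphisms := by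
    have := hp.eqv
    have : (Monad.comparison hp.adj ⋙ hp.adj.toMonad.forget).ReflectsIsomorphisms := inferInstance
    exact this
  -- If `b` is not in the image of `p`, the inclusion of the empty set into the point `b` pulls back
  -- to a map between empty sets, an isomorphism, although it is not one itself.
  let X : Over B := Over.mk (Preord.ofHom (X := PEmpty) (Y := B) ⟨PEmpty.elim, fun x => x.elim⟩)
  let Y : Over B := Over.mk (Preord.ofHom (X := PUnit) (Y := B) ⟨fun _ => b, fun _ _ _ => le_rfl⟩)
  let h : X ⟶ Y := Over.homMk
    (Preord.ofHom (X := PEmpty) (Y := PUnit) ⟨PEmpty.elim, fun x => x.elim⟩)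
    (Preord.ext fun x => PEmpty.elim x)
  have hY : ∀ z : ((Over.pullback p).obj Y).left, False := fun z =>
    hb ⟨_, (ConcreteCategory.congr_hom (pullback.condition (f := Y.hom) (g := p)) z).symm⟩
  have hiso : IsIso ((Over.pullback p).map h) := by
    have : IsIso ((Over.pullback p).map h).left :=
      isIso_of_bijective _ ⟨fun z => (hY (((Over.pullback p).map h).left z)).elim,
        fun z => (hY z).elim⟩ fun z => (hY (((Over.pullback p).map h).left z)).elim
    have : IsIso ((Over.forget E).map ((Over.pullback p).map h)) := this
    exact isIso_of_reflects_iso _ (Over.forget E)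
  have hh : IsIso h := isIso_of_reflects_iso h (Over.pullback p)
  exact PEmpty.elim ((inv h).left PUnit.unit)


/-! ### Lifting chains suffices for effective descent. -/

section Descent

variable {E B : Preord.{u}} (p : E ⟶ B)

/-- The relation on the codomain of a parallel pair that identifies the two images of each
element. -/
def pairRel {X Y : Preord.{u}} (f g : X ⟶ Y) (y y' : Y) : Prop := ∃ x, f x = y ∧ g x = y'

theorem eq_of_eqvGen_pairRel {X Y Z : Preord.{u}} {f g : X ⟶ Y} {π : Y ⟶ Z} (w : f ≫ π = g ≫ π)
    {y y' : Y} (h : Relation.EqvGen (pairRel f g) y y') : π y = π y' := by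
  induction h with
  | rel _ _ h =>
    obtain ⟨x, rfl, rfl⟩ := h
    exact ConcreteCategory.congr_hom w x
  | refl _ => rfl
  | symm _ _ _ ih => exact ih.symm
  | trans _ _ _ _ _ ih ih' => exact ih.trans ih'

/-- A cofork over `B` is a coequalizer if its order is the image order and its fibres are the
classes of the equivalence relation generated by the parallel pair. -/
theorem nonempty_isColimit_cofork {X Y Z : Over B} {f g : X ⟶ Y} {π : Y ⟶ Z} (w : f ≫ π = g ≫ π)
    (hle : ∀ z z' : Z.left, z ≤ z' → ∃ y y' : Y.left, π.left y = z ∧ π.left y' = z' ∧ y ≤ y')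
    (hrel : ∀ y y' : Y.left, π.left y = π.left y' →
      Relation.EqvGen (pairRel f.left g.left) y y') :
    Nonempty (IsColimit (Cofork.ofπ π w)) := by
  have hsurj : Function.Surjective π.left := fun z =>
    let ⟨y, _, hy, _⟩ := hle z z le_rfl
    ⟨y, hy⟩
  have hwd : ∀ {W : Over B} (k : Y ⟶ W), f ≫ k = g ≫ k → ∀ y y' : Y.left,
      π.left y = π.left y' → k.left y = k.left y' := fun k hk y y' h =>
    eq_of_eqvGen_pairRel (by rw [← Over.comp_left, hk, Over.comp_left]) (hrel y y' h)
  have hs := Function.surjInv_eq hsurj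
  -- The map induced on `Z` is computed on chosen representatives; `hwd` makes the choice
  -- irrelevant, and the image order then gives monotonicity.
  let d : ∀ {W : Over B} (k : Y ⟶ W), f ≫ k = g ≫ k → (Z.left ⟶ W.left) := fun {W} k hk =>
    Preord.ofHom (X := Z.left) (Y := W.left)
      ⟨fun z => k.left (Function.surjInv hsurj z), fun z z' h => by
        obtain ⟨y, y', rfl, rfl, hyy'⟩ := hle z z' h
        beta_reduce
        rw [hwd k hk _ y (hs _), hwd k hk _ y' (hs _)]
        exact k.left.hom.monotone hyy'⟩
  have hd : ∀ {W : Over B} (k : Y ⟶ W) (hk : f ≫ k = g ≫ k) (y : Y.left),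
      d k hk (π.left y) = k.left y := fun k hk y => hwd k hk _ _ (hs _)
  refine ⟨Cofork.IsColimit.mk' _ fun s => ⟨Over.homMk (d s.π s.condition) ?_, ?_, ?_⟩⟩
  · refine Preord.ext fun z => ?_
    obtain ⟨y, rfl⟩ := hsurj z
    rw [Preord.comp_apply, hd s.π s.condition]
    exact (ConcreteCategory.congr_hom (Over.w s.π) y).trans
      (ConcreteCategory.congr_hom (Over.w π) y).symm
  · exact Over.OverMorphism.ext (Preord.ext fun y => hd s.π s.condition y)
  · intro m hm
    refine Over.OverMorphism.ext (Preord.ext fun z => ?_)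
    obtain ⟨y, rfl⟩ := hsurj z
    refine Eq.trans ?_ (hd s.π s.condition y).symm
    exact ConcreteCategory.congr_hom (congrArg CommaMorphism.left hm) y

/-- The quotient of `Y` by the equivalence relation generated by a parallel pair, with the image
order, when the latter is transitive. -/
def imageQuotient {X Y : Preord.{u}} (f g : X ⟶ Y)
    (h : ∀ a b c d : Y, a ≤ b → Relation.EqvGen (pairRel f g) b c → c ≤ d →
      ∃ a' d', Relation.EqvGen (pairRel f g) a' a ∧ Relation.EqvGen (pairRel f g) d' d ∧ a' ≤ d') :
    Preord.{u} where
  carrier := Quot (pairRel f g)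
  str :=
    { le := fun z z' => ∃ y y', Quot.mk _ y = z ∧ Quot.mk _ y' = z' ∧ y ≤ y'
      le_refl := fun z => Quot.inductionOn z fun y => ⟨y, y, rfl, rfl, le_rfl⟩
      le_trans := by
        rintro _ _ _ ⟨a, b, rfl, rfl, hab⟩ ⟨c, d, hcb, rfl, hcd⟩
        obtain ⟨a', d', ha, hd, had⟩ := h a b c d hab (Quot.eqvGen_exact hcb.symm) hcd
        exact ⟨a', d', Quot.eqvGen_sound ha, Quot.eqvGen_sound hd, had⟩ }

/-- The property of lifting chains of length two, a sufficient condition for `p` to be an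
effective descent morphism of preordered sets. -/
def LiftsChains : Prop :=
  ∀ b₀ b₁ b₂ : B, b₀ ≤ b₁ → b₁ ≤ b₂ →
    ∃ e₀ e₁ e₂ : E, p e₀ = b₀ ∧ p e₁ = b₁ ∧ p e₂ = b₂ ∧ e₀ ≤ e₁ ∧ e₁ ≤ e₂

variable {p}

theorem isPullback_pullback_obj (X : Over B) :
    IsPullback (pullback.fst X.hom p) ((Over.pullback p).obj X).hom X.hom p :=
  IsPullback.of_hasPullback X.hom p

theorem fst_pullback_map {X Y : Over B} (f : X ⟶ Y) (z : ((Over.pullback p).obj X).left) :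
    pullback.fst Y.hom p (((Over.pullback p).map f).left z) = f.left (pullback.fst X.hom p z) :=
  ConcreteCategory.congr_hom (pullback.lift_fst (f := Y.hom) (g := p) _ _ _) z

theorem hom_apply {X Y : Over B} (f : X ⟶ Y) (x : X.left) : Y.hom (f.left x) = X.hom x :=
  ConcreteCategory.congr_hom (Over.w f) x

theorem hom_eq_of_eqvGen_pairRel {X Y : Over B} {f g : X ⟶ Y} {y y' : Y.left}
    (h : Relation.EqvGen (pairRel f.left g.left) y y') : Y.hom y = Y.hom y' :=
  eq_of_eqvGen_pairRel ((Over.w f).trans (Over.w g).symm) h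

/-- Pulling back preserves the equivalence relation generated by a parallel pair. -/
theorem eqvGen_pullback {X Y : Over B} {f g : X ⟶ Y} {y y' : Y.left}
    (h : Relation.EqvGen (pairRel f.left g.left) y y') :
    ∀ z z' : ((Over.pullback p).obj Y).left, pullback.fst Y.hom p z = y →
      pullback.fst Y.hom p z' = y' →
      ((Over.pullback p).obj Y).hom z = ((Over.pullback p).obj Y).hom z' →
      Relation.EqvGen
        (pairRel ((Over.pullback p).map f).left ((Over.pullback p).map g).left) z z' := by
  have hY := isPullback_pullback_obj (p := p) Y
  induction h with
  | rel y y' h =>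
    rintro z z' hz hz' hzz'
    obtain ⟨x, rfl, rfl⟩ := h
    have hw := ConcreteCategory.congr_hom hY.w z
    -- The generating element `x` lies over the same point of `B` as `y` and `y'`, so it can be
    -- paired with the common coordinate of `z` and `z'` in `E`.
    obtain ⟨t, ht, ht'⟩ := exists_of_isPullback (isPullback_pullback_obj (p := p) X) x
      (((Over.pullback p).obj Y).hom z) (by
        rw [Preord.comp_apply, Preord.comp_apply, hz, hom_apply] at hw
        exact hw)
    refine .rel _ _ ⟨t, ext_of_isPullback hY ?_ ?_, ext_of_isPullback hY ?_ ?_⟩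
    · rw [fst_pullback_map, ht, hz]
    · rw [hom_apply, ht']
    · rw [fst_pullback_map, ht, hz']
    · rw [hom_apply, ht', hzz']
  | refl y =>
    rintro z z' hz hz' hzz'
    rw [ext_of_isPullback hY (hz.trans hz'.symm) hzz']
    exact .refl _
  | symm y y' _ ih =>
    rintro z z' hz hz' hzz'
    exact (ih z' z hz' hz hzz'.symm).symm
  | trans y y' y'' h _ ih ih' =>
    rintro z z' hz hz' hzz'
    have hw := ConcreteCategory.congr_hom hY.w z
    -- A zigzag stays in one fibre over `B`, so its intermediate points lift with the same
    -- coordinate in `E`.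
    obtain ⟨t, ht, ht'⟩ := exists_of_isPullback hY y' (((Over.pullback p).obj Y).hom z) (by
      rw [Preord.comp_apply, Preord.comp_apply, hz, hom_eq_of_eqvGen_pairRel h] at hw
      exact hw)
    exact (ih z t hz ht ht'.symm).trans _ _ _ (ih' t z' ht hz' (ht'.trans hzz'))

/-- If the pullback of a parallel pair along a morphism lifting chains is split, the image order on
the set-theoretical coequalizer is transitive. -/
theorem LiftsChains.image_trans (hp : LiftsChains p) {X Y : Over B} (f g : X ⟶ Y)
    [hs : (Over.pullback p).IsSplitPair f g] (a b c d : Y.left) (hab : a ≤ b)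
    (hbc : Relation.EqvGen (pairRel f.left g.left) b c) (hcd : c ≤ d) :
    ∃ a' d', Relation.EqvGen (pairRel f.left g.left) a' a ∧
      Relation.EqvGen (pairRel f.left g.left) d' d ∧ a' ≤ d' := by
  obtain ⟨Q, q, ⟨S⟩⟩ := hs.splittable
  have hY := isPullback_pullback_obj (p := p) Y
  -- The left section of the splitting supplies the element of `X` that relates each point to its
  -- representative under `q` followed by the right section.
  have hsect : ∀ z : ((Over.pullback p).obj Y).left, Relation.EqvGen (pairRel f.left g.left)
      (pullback.fst Y.hom p (S.rightSection.left (q.left z))) (pullback.fst Y.hom p z) := by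
    intro z
    refine .rel _ _ ⟨pullback.fst X.hom p (S.leftSection.left z), ?_, ?_⟩
    · rw [← fst_pullback_map]
      exact congrArg _ (ConcreteCategory.congr_hom (congrArg CommaMorphism.left S.leftSection_top) z)
    · rw [← fst_pullback_map]
      exact congrArg _
        (ConcreteCategory.congr_hom (congrArg CommaMorphism.left S.leftSection_bottom) z)
  have hbc' := hom_eq_of_eqvGen_pairRel hbc
  -- Since `b` and `c` lie over the same point of `B`, both can be lifted with the middle coordinate
  -- `e₁`, so that their lifts become equal in `Q`.
  obtain ⟨e₀, e₁, e₂, h₀, h₁, h₂, h₀₁, h₁₂⟩ := hp (Y.hom a) (Y.hom b) (Y.hom d)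
    (Y.hom.hom.monotone hab) (hbc' ▸ Y.hom.hom.monotone hcd)
  obtain ⟨za, ha, ha'⟩ := exists_of_isPullback hY a e₀ h₀.symm
  obtain ⟨zb, hb, hb'⟩ := exists_of_isPullback hY b e₁ h₁.symm
  obtain ⟨zc, hc, hc'⟩ := exists_of_isPullback hY c e₁ (hbc'.symm.trans h₁.symm)
  obtain ⟨zd, hd, hd'⟩ := exists_of_isPullback hY d e₂ h₂.symm
  have hq : q.left zb = q.left zc :=
    eq_of_eqvGen_pairRel (congrArg CommaMorphism.left S.condition)
      (eqvGen_pullback hbc zb zc hb hc (hb'.trans hc'.symm))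
  have hab' : za ≤ zb := le_of_isPullback hY (by rwa [ha, hb]) (by rwa [ha', hb'])
  have hcd' : zc ≤ zd := le_of_isPullback hY (by rwa [hc, hd]) (by rwa [hc', hd'])
  -- Transitivity already holds in the preorder `Q`; the monotone right section carries the
  -- comparison back to representatives.
  have key : q.left za ≤ q.left zd :=
    (q.left.hom.monotone hab').trans (hq.le.trans (q.left.hom.monotone hcd'))
  exact ⟨_, _, ha ▸ hsect za, hd ▸ hsect zd,
    (pullback.fst Y.hom p).hom.monotone (S.rightSection.left.hom.monotone key)⟩

/-- A parallel pair split by the pullback functor along a morphism lifting chains has a coequalizer,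
which this functor preserves. -/
theorem LiftsChains.exists_coequalizer (hp : LiftsChains p) {X Y : Over B} (f g : X ⟶ Y)
    [hs : (Over.pullback p).IsSplitPair f g] :
    ∃ (Z : Over B) (π : Y ⟶ Z) (w : f ≫ π = g ≫ π), Nonempty (IsColimit (Cofork.ofπ π w)) ∧
      Nonempty (IsColimit ((Over.pullback p).mapCocone (Cofork.ofπ π w))) := by
  let C : Preord.{u} := imageQuotient f.left g.left (hp.image_trans f g)
  let Z : Over B := Over.mk (Preord.ofHom (X := C) (Y := B)
    ⟨Quot.lift Y.hom fun y y' h => hom_eq_of_eqvGen_pairRel (.rel _ _ h), by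
      rintro _ _ ⟨y, y', rfl, rfl, h⟩
      exact Y.hom.hom.monotone h⟩)
  let π : Y ⟶ Z := Over.homMk (Preord.ofHom (X := Y.left) (Y := C)
    ⟨Quot.mk _, fun y y' h => ⟨y, y', rfl, rfl, h⟩⟩) rfl
  have w : f ≫ π = g ≫ π :=
    Over.OverMorphism.ext (Preord.ext fun x => Quot.sound ⟨x, rfl, rfl⟩)
  have hY := isPullback_pullback_obj (p := p) Y
  have hZ := isPullback_pullback_obj (p := p) Z
  refine ⟨Z, π, w, nonempty_isColimit_cofork w (fun _ _ h => h) fun y y' h =>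
    Quot.eqvGen_exact h, ?_⟩
  refine (nonempty_isColimit_cofork (f := (Over.pullback p).map f) (g := (Over.pullback p).map g)
    (π := (Over.pullback p).map π) (by rw [← Functor.map_comp, w, Functor.map_comp]) ?_ ?_).map
    (isColimitMapCoconeCoforkEquiv (Over.pullback p) w).symm
  · intro z z' h
    -- Representatives witnessing the image order in `Z` are paired with the coordinates of `z` and
    -- `z'` in `E`, which are already comparable.
    obtain ⟨y, y', hy, hy', hyy'⟩ := (pullback.fst Z.hom p).hom.monotone h
    have hw : ∀ (z : ((Over.pullback p).obj Z).left) (y : Y.left),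
        π.left y = pullback.fst Z.hom p z → Y.hom y = p (((Over.pullback p).obj Z).hom z) := by
      intro z y hy
      rw [← hom_apply π, hy]
      exact ConcreteCategory.congr_hom hZ.w z
    obtain ⟨t, ht₁, ht₂⟩ := exists_of_isPullback hY y _ (hw z y hy)
    obtain ⟨t', ht₁', ht₂'⟩ := exists_of_isPullback hY y' _ (hw z' y' hy')
    refine ⟨t, t', ext_of_isPullback hZ ?_ ?_, ext_of_isPullback hZ ?_ ?_,
      le_of_isPullback hY ?_ ?_⟩
    · rw [fst_pullback_map, ht₁]; exact hy
    · rw [hom_apply, ht₂]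
    · rw [fst_pullback_map, ht₁']; exact hy'
    · rw [hom_apply, ht₂']
    · rwa [ht₁, ht₁']
    · rw [ht₂, ht₂']
      exact ((Over.pullback p).obj Z).hom.hom.monotone h
  · intro z z' h
    refine eqvGen_pullback (Quot.eqvGen_exact ?_) z z' rfl rfl ?_
    · have := congrArg (pullback.fst Z.hom p) h
      rw [fst_pullback_map, fst_pullback_map] at this
      exact this
    · rw [← hom_apply ((Over.pullback p).map π), h, hom_apply]

/-- Surjectivity of `p` transfers bijectivity from the pullback; lifting a single inequality of `B`
transfers the reflection of the order. -/
theorem LiftsChains.reflectsIsomorphisms (hp : LiftsChains p) :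
    (Over.pullback p).ReflectsIsomorphisms where
  reflects {X Y} f hf := by
    have hX := isPullback_pullback_obj (p := p) X
    have hY := isPullback_pullback_obj (p := p) Y
    have hsurj : ∀ b, ∃ e, p e = b := fun b =>
      let ⟨e, _, _, he, _⟩ := hp b b b le_rfl le_rfl
      ⟨e, he⟩
    let k := (inv ((Over.pullback p).map f)).left
    have hk : ∀ z, k (((Over.pullback p).map f).left z) = z := fun z =>
      ConcreteCategory.congr_hom
        (congrArg CommaMorphism.left (IsIso.hom_inv_id ((Over.pullback p).map f))) z
    have hk' : ∀ z, ((Over.pullback p).map f).left (k z) = z := fun z =>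
      ConcreteCategory.congr_hom
        (congrArg CommaMorphism.left (IsIso.inv_hom_id ((Over.pullback p).map f))) z
    have : IsIso f.left := by
      refine isIso_of_bijective _ ⟨fun x x' h => ?_, fun y => ?_⟩ fun x x' h => ?_
      · obtain ⟨e, he⟩ := hsurj (X.hom x)
        obtain ⟨z, hz, hz'⟩ := exists_of_isPullback hX x e he.symm
        obtain ⟨t, ht, ht'⟩ := exists_of_isPullback hX x' e
          (by rw [he, ← hom_apply f, ← hom_apply f, h])
        have : z = t := by
          rw [← hk z, ← hk t]
          refine congrArg _ (ext_of_isPullback hY ?_ ?_)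
          · rw [fst_pullback_map, fst_pullback_map, hz, ht, h]
          · rw [hom_apply, hom_apply, hz', ht']
        rw [← hz, ← ht, this]
      · obtain ⟨e, he⟩ := hsurj (Y.hom y)
        obtain ⟨z, hz, -⟩ := exists_of_isPullback hY y e he.symm
        exact ⟨pullback.fst X.hom p (k z), by rw [← fst_pullback_map, hk', hz]⟩
      · obtain ⟨e, e', -, he, he', -, hee', -⟩ := hp (X.hom x) (X.hom x') (X.hom x')
          (by rw [← hom_apply f, ← hom_apply f]; exact Y.hom.hom.monotone h) le_rfl
        obtain ⟨z, hz, hz'⟩ := exists_of_isPullback hX x e he.symm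
        obtain ⟨t, ht, ht'⟩ := exists_of_isPullback hX x' e' he'.symm
        have : ((Over.pullback p).map f).left z ≤ ((Over.pullback p).map f).left t := by
          refine le_of_isPullback hY ?_ ?_
          · rwa [fst_pullback_map, fst_pullback_map, hz, ht]
          · rwa [hom_apply, hom_apply, hz', ht']
        have := k.hom.monotone this
        rw [hk, hk] at this
        rw [← hz, ← ht]
        exact (pullback.fst X.hom p).hom.monotone this
    have : IsIso ((Over.forget B).map f) := this
    exact isIso_of_reflects_iso f (Over.forget B)

/-- Beck's monadicity theorem, in the form asking for conservativity together with existence and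
preservation of coequalizers of the pairs split by the pullback functor. -/
theorem LiftsChains.isEffectiveDescent (hp : LiftsChains p) : IsEffectiveDescent p := by
  have := hp.reflectsIsomorphisms
  have : Monad.HasCoequalizerOfIsSplitPair (Over.pullback p) := ⟨fun f g _ => by
    obtain ⟨Z, π, w, ⟨h⟩, -⟩ := hp.exists_coequalizer f g
    exact ⟨⟨_, h⟩⟩⟩
  have : Monad.PreservesColimitOfIsSplitPair (Over.pullback p) := ⟨fun f g _ => by
    obtain ⟨Z, π, w, ⟨h⟩, ⟨h'⟩⟩ := hp.exists_coequalizer f g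
    exact preservesColimit_of_preserves_colimit_cocone h h'⟩
  exact ⟨Monad.monadicOfHasPreservesGSplitCoequalizersOfReflectsIsomorphisms
    (Over.mapPullbackAdj p)⟩

/-- The partially ordered set `B × ℕ` in which distinct pairs are comparable when both their first
components and, strictly, their second components are. -/
def levels (B : Preord.{u}) : Preord.{u} where
  carrier := B × ℕ
  str :=
    { le := fun x y => x = y ∨ x.1 ≤ y.1 ∧ x.2 < y.2
      lt := fun x y => (x = y ∨ x.1 ≤ y.1 ∧ x.2 < y.2) ∧ ¬(y = x ∨ y.1 ≤ x.1 ∧ y.2 < x.2)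
      lt_iff_le_not_ge := fun _ _ => Iff.rfl
      le_refl := fun _ => Or.inl rfl
      le_trans := by
        rintro x y z (rfl | h) (rfl | h')
        · exact Or.inl rfl
        · exact Or.inr h'
        · exact Or.inr h
        · exact Or.inr ⟨h.1.trans h'.1, h.2.trans h'.2⟩ }

theorem parOrd_levels (B : Preord.{u}) : parOrd (levels B) := by
  rintro x y (h | h) (h' | h')
  · exact h
  · exact h
  · exact h'.symm
  · exact (lt_asymm h.2 h'.2).elim

/-- The projection of `levels B` onto `B`. -/
def levelsπ (B : Preord.{u}) : levels B ⟶ B :=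
  Preord.ofHom (X := levels B) (Y := B) ⟨Prod.fst, by
    rintro x y (rfl | h)
    · exact le_rfl
    · exact h.1⟩

/-- Placing the points on strictly increasing levels lifts any chain, even one with repeated or
equivalent members, while keeping the source antisymmetric. -/
theorem liftsChains_levelsπ (B : Preord.{u}) : LiftsChains (levelsπ B) :=
  fun b₀ b₁ b₂ h h' => ⟨(b₀, 0), (b₁, 1), (b₂, 2), rfl, rfl, rfl, Or.inr ⟨h, zero_lt_one⟩,
    Or.inr ⟨h', one_lt_two⟩⟩

end Descent

/-! ### Coverings -/

theorem isCovering_iff_parOrd_nKer {A B : Preord.{u}} (f : A ⟶ B) :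
    IsCovering preordToPartOrdForgetAdjunction f ↔ parOrd (nKer f) := by
  constructor
  · rintro ⟨E, p, hp, ht⟩ a a' ⟨h, haa'⟩ ⟨h', -⟩
    have hP := IsPullback.of_hasPullback p f
    obtain ⟨e, he⟩ := hp.surjective (f a)
    obtain ⟨z, hz, hza⟩ := exists_of_isPullback hP e a he
    -- The same `e` serves for `a'` because `f a = f a'`.
    obtain ⟨z', hz', hza'⟩ := exists_of_isPullback hP e a' (he.trans haa')
    have hzz' : z = z' := ht.eq_of_le_of_ge
      (le_of_isPullback hP (hz.trans hz'.symm).le (by rw [hza, hza']; exact h))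
      (le_of_isPullback hP (hz'.trans hz.symm).le (by rw [hza, hza']; exact h'))
      (hz.trans hz'.symm)
    exact hza.symm.trans ((congrArg _ hzz').trans hza')
  · intro hf
    have hP := IsPullback.of_hasPullback (levelsπ B) f
    refine ⟨levels B, levelsπ B, (liftsChains_levelsπ B).isEffectiveDescent,
      isTrivialCovering_of_parOrd _ (fun z z' h h' => ?_) (parOrd_levels B)⟩
    -- Antisymmetry of `levels B` makes the first coordinates equal; the second coordinates then lie
    -- in one fibre of `f`, where antisymmetry of `nKer f` applies.
    have h₁ := parOrd_levels B _ _ ((pullback.fst (levelsπ B) f).hom.monotone h)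
      ((pullback.fst (levelsπ B) f).hom.monotone h')
    have hfz : f (pullback.snd (levelsπ B) f z) = f (pullback.snd (levelsπ B) f z') :=
      (ConcreteCategory.congr_hom hP.w z).symm.trans
        ((congrArg (levelsπ B) h₁).trans (ConcreteCategory.congr_hom hP.w z'))
    exact ext_of_isPullback hP h₁ (hf _ _
      ⟨(pullback.snd (levelsπ B) f).hom.monotone h, hfz⟩
      ⟨(pullback.snd (levelsπ B) f).hom.monotone h', hfz.symm⟩)

end PreOrdGalois

/-- The morphism `(A, ρ ∧ Eq(f)) ⟶ (A, ρ)` is an `𝒩`-kernel of `f`; and `f` is a covering for the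
Galois structure of the reflection of preordered sets onto partially ordered sets if and only if its
`𝒩`-kernel (the one above or, equivalently, any other) is a partial order. -/
theorem mainTheorem8 {A B : Preord.{u}} (f : A ⟶ B) :
    PreOrdGalois.IsNKernel (PreOrdGalois.FactorsThrough PreOrdGalois.dis)
        (PreOrdGalois.nKerι f) f ∧
      (PreOrdGalois.IsCovering preordToPartOrdForgetAdjunction f ↔
        PreOrdGalois.parOrd (PreOrdGalois.nKer f)) ∧
      ∀ {K : Preord.{u}} (κ : K ⟶ A),
        PreOrdGalois.IsNKernel (PreOrdGalois.FactorsThrough PreOrdGalois.dis) κ f →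
          (PreOrdGalois.IsCovering preordToPartOrdForgetAdjunction f ↔
            PreOrdGalois.parOrd K) :=
  ⟨PreOrdGalois.isNKernel_nKerι f, PreOrdGalois.isCovering_iff_parOrd_nKer f, fun _ hκ =>
    have ⟨i⟩ := hκ.nonempty_iso (PreOrdGalois.isNKernel_nKerι f)
    (PreOrdGalois.isCovering_iff_parOrd_nKer f).trans
      ⟨PreOrdGalois.parOrd_of_iso i.symm, PreOrdGalois.parOrd_of_iso i⟩⟩
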